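/- Let $F$ be a field with $\mathrm{char}(F)\neq 2$, let $V$ be a non-zero finite dimensional vector space over $F$, let $n=\dim V$, and let $f:V\times V\to F$ be a bilinear form. Let $L(f)=\{x\in\mathfrak{gl}(V) : f(xv,w)=-f(v,xw)\text{ for all }v,w\in V\}$, and similarly for restrictions of $f$ to subspaces. A Lie algebra is called reductive if all its solvable ideals are central. A bilinear form on a non-zero space is called indecomposable if the space is not the direct sum of two non-zero subspaces $A,B$ with $f(A,B)=0=f(B,A)$. Let $J_k$ be the lower triangular nilpotent Jordan block of size $k$. Let $V=U_1\oplus\cdots\oplus U_m$ be any decomposition such that $f(U_i,U_j)=0$ for all $i\ne j$ and each restriction $f|_{U_i}$ is indecomposable (such decompositions exist). Let $V_{\mathrm{even}}$ (resp. $V_{\mathrm{odd}}$) be the sum of all $U_i$ such that $f|_{U_i}$ has Gram matrix $J_k$, relative to some basis of $U_i$, with $k$ even (resp. odd), let $V_{\mathrm{ndeg}}$ be the sum of all other $U_i$, and let $f_{\mathrm{even}}$ and $f_{\mathrm{ndeg}}$ be the restrictions of $f$ to $V_{\mathrm{even}}$ and $V_{\mathrm{ndeg}}$. Then $L(f)$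 is reductive if and only if either $f=0$, in which case $L(f)\cong\mathfrak{gl}(n,F)$, or else $V_{\mathrm{odd}}=0$ and $L(f_{\mathrm{even}})$, $L(f_{\mathrm{ndeg}})$ are both reductive. Moreover, in the latter case $L(f)\cong L(f_{\mathrm{even}})\oplus L(f_{\mathrm{ndeg}})$ as Lie algebras over $F$. -/

import Mathlib

open LinearMap (BilinForm)

attribute [local instance 100] LieRing.ofAssociativeRing

namespace FormLie

/-- A Lie algebra is reductive if every solvable ideal is central (this is the definition used
over fields of arbitrary characteristic). -/
def IsReductive (F : Type*) (L : Type*) [CommRing F] [LieRing L] [LieAlgebra F L] : Prop :=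
  ∀ I : LieIdeal F L, LieAlgebra.IsSolvable I → I ≤ LieAlgebra.center F L

variable {F : Type*} {V : Type*} [Field F] [AddCommGroup V] [Module F V]

/-- The Lie algebra `L(f)` of endomorphisms that are skew-adjoint with respect to `f`. -/
abbrev L (f : BilinForm F V) : LieSubalgebra F (Module.End F V) :=
  skewAdjointLieSubalgebra f

theorem mem_L (f : BilinForm F V) (x : Module.End F V) :
    x ∈ L f ↔ ∀ v w, f (x v) w = -f v (x w) := by
  change x ∈ f.skewAdjointSubmodule ↔ _
  rw [LinearMap.mem_skewAdjointSubmodule]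
  simp [LinearMap.IsSkewAdjoint, LinearMap.IsAdjointPair]

/-- `f(A, B) = 0` and `f(B, A) = 0`. -/
def Orthogonal (f : BilinForm F V) (A B : Submodule F V) : Prop :=
  ∀ a ∈ A, ∀ b ∈ B, f a b = 0 ∧ f b a = 0

/-- A bilinear form on a non-zero space is indecomposable if the space is not the direct sum of
two non-zero subspaces that are orthogonal on both sides. -/
def Indecomposable (f : BilinForm F V) : Prop :=
  Nontrivial V ∧
    ∀ A B : Submodule F V, IsCompl A B → Orthogonal f A B → A = ⊥ ∨ B = ⊥

/-- The lower triangular nilpotent Jordan block `J_n`, with ones just below the diagonal. -/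
def J (F : Type*) [Field F] (n : ℕ) : Matrix (Fin n) (Fin n) F :=
  Matrix.of fun i j => if (i : ℕ) = (j : ℕ) + 1 then 1 else 0

/-- `f` has Gram matrix `S` relative to some basis: `S i j = f (v i) (v j)`. -/
def HasGramMatrix (f : BilinForm F V) {n : ℕ} (S : Matrix (Fin n) (Fin n) F) : Prop :=
  ∃ v : Module.Basis (Fin n) F V, ∀ i j, f (v i) (v j) = S i j

/-- `V = U_1 ⟂ ⋯ ⟂ U_m` with every restriction of `f` to `U_i` indecomposable. -/
structure IsIndecomposableDecomposition (f : BilinForm F V) {m : ℕ}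
    (U : Fin m → Submodule F V) : Prop where
  isInternal : DirectSum.IsInternal U
  orthogonal : ∀ i j, i ≠ j → Orthogonal f (U i) (U j)
  indecomposable : ∀ i, Indecomposable (f.restrict (U i))

section Parts

variable (f : BilinForm F V) {m : ℕ} (U : Fin m → Submodule F V)

/-- The sum of all `U_i` on which `f` has Gram matrix `J_n` with `n` even. -/
def evenPart : Submodule F V :=
  ⨆ i ∈ {i | ∃ n, Even n ∧ HasGramMatrix (f.restrict (U i)) (J F n)}, U i

/-- The sum of all `U_i` on which `f` has Gram matrix `J_n` with `n` odd. -/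
def oddPart : Submodule F V :=
  ⨆ i ∈ {i | ∃ n, Odd n ∧ HasGramMatrix (f.restrict (U i)) (J F n)}, U i

/-- The sum of all other `U_i`. -/
def ndegPart : Submodule F V :=
  ⨆ i ∈ {i | ¬ ∃ n, HasGramMatrix (f.restrict (U i)) (J F n)}, U i

end Parts

theorem exists_finset_decomposition [FiniteDimensional F V] (f : BilinForm F V) (d : ℕ) :
    ∀ W : Submodule F V, Module.finrank F W = d →
      ∃ s : Finset (Submodule F V), s.SupIndep id ∧ s.sup id = W ∧
        (∀ A ∈ s, ∀ B ∈ s, A ≠ B → Orthogonal f A B) ∧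
        ∀ A ∈ s, Indecomposable (f.restrict A) := by
  classical
  induction d using Nat.strong_induction_on with
  | _ d ih =>
    intro W hW
    by_cases h0 : W = ⊥
    · exact ⟨∅, by simp, by simp [h0], by simp, by simp⟩
    by_cases hI : Indecomposable (f.restrict W)
    · refine ⟨{W}, Finset.supIndep_singleton _ _, by simp, ?_, by simpa using hI⟩
      intro A hA B hB hAB
      simp only [Finset.mem_singleton] at hA hB
      exact absurd (hA.trans hB.symm) hAB
    have hnt : Nontrivial W := Submodule.nontrivial_iff_ne_bot.2 h0
    simp only [Indecomposable, hnt, true_and, not_forall, not_or] at hI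
    obtain ⟨A, B, hc, ho, hA, hB⟩ := hI
    have hfin : Module.finrank F A + Module.finrank F B = d := by
      rw [Submodule.finrank_add_eq_of_isCompl hc, hW]
    have hA0 : 0 < Module.finrank F A := by
      have := Submodule.nontrivial_iff_ne_bot.2 hA
      exact Module.finrank_pos
    have hB0 : 0 < Module.finrank F B := by
      have := Submodule.nontrivial_iff_ne_bot.2 hB
      exact Module.finrank_pos
    have key : ∀ C : Submodule F W, Module.finrank F (C.map W.subtype) = Module.finrank F C :=
      fun C => (Submodule.equivMapOfInjective _ W.injective_subtype C).finrank_eq.symm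
    obtain ⟨s, hs1, hs2, hs3, hs4⟩ := ih _ (by omega) (A.map W.subtype) (key A)
    obtain ⟨t, ht1, ht2, ht3, ht4⟩ := ih _ (by omega) (B.map W.subtype) (key B)
    have hdisj : Disjoint (A.map W.subtype) (B.map W.subtype) :=
      Submodule.disjoint_map W.injective_subtype hc.disjoint
    have hAB : Orthogonal f (A.map W.subtype) (B.map W.subtype) := by
      rintro _ ⟨a, ha, rfl⟩ _ ⟨b, hb, rfl⟩
      exact ho a ha b hb
    have hsA : ∀ C ∈ s, C ≤ A.map W.subtype := fun C hC =>
      hs2 ▸ Finset.le_sup (f := id) hC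
    have htB : ∀ C ∈ t, C ≤ B.map W.subtype := fun C hC =>
      ht2 ▸ Finset.le_sup (f := id) hC
    refine ⟨s ∪ t, hs1.union ht1 (by rwa [hs2, ht2]), ?_, ?_, ?_⟩
    · rw [Finset.sup_union, hs2, ht2, ← Submodule.map_sup, hc.sup_eq_top, Submodule.map_top,
        Submodule.range_subtype]
    · intro C hC D hD hCD
      rcases Finset.mem_union.1 hC with hC | hC <;> rcases Finset.mem_union.1 hD with hD | hD
      · exact hs3 C hC D hD hCD
      · exact fun c hc d hd => hAB c (hsA C hC hc) d (htB D hD hd)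
      · exact fun c hc d hd => (hAB d (hsA D hD hd) c (htB C hC hc)).symm
      · exact ht3 C hC D hD hCD
    · intro C hC
      rcases Finset.mem_union.1 hC with hC | hC
      · exact hs4 C hC
      · exact ht4 C hC

/-- Every bilinear form on a finite dimensional space has such a decomposition. -/
theorem exists_isIndecomposableDecomposition [FiniteDimensional F V] (f : BilinForm F V) :
    ∃ (m : ℕ) (U : Fin m → Submodule F V), IsIndecomposableDecomposition f U := by
  classical
  obtain ⟨s, hs, hsup, ho, hi⟩ := exists_finset_decomposition f _ ⊤ rfl
  refine ⟨s.card, fun i => (s.equivFin.symm i : Submodule F V), ?_, ?_, ?_⟩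
  · rw [DirectSum.isInternal_submodule_iff_iSupIndep_and_iSup_eq_top]
    have hs' : iSupIndep (fun A : s => (A : Submodule F V)) :=
      iSupIndep_comp_coe_iff_supIndep.2 hs
    refine ⟨hs'.comp s.equivFin.symm.injective, ?_⟩
    rw [s.equivFin.symm.iSup_comp (g := fun A : s => (A : Submodule F V)), iSup_subtype,
      ← hsup, Finset.sup_eq_iSup]
    rfl
  · intro i j hij
    exact ho _ (Subtype.coe_prop _) _ (Subtype.coe_prop _)
      fun h => hij (s.equivFin.symm.injective (Subtype.ext h))
  · exact fun i => hi _ (Subtype.coe_prop _)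

end FormLie

/-! If `f = 0` then `L f` is all of `gl(V)`, which is reductive because `2` is invertible. Suppose
`f ≠ 0`.

An indecomposable form with a nonzero left radical is a block `J_n`
(`Indecomposable.exists_hasGramMatrix`), so `f` is nondegenerate on `ndegPart`. The ends of chains
`0 = u 0, …, u k` with `f(u (i+1), ·) = f(·, u i)` form a totally isotropic `L f`-invariant subspace
lying in any summand whose orthogonal complement is nondegenerate. A block `J_n` with `n` even is
spanned by its chain ends for `f` and for `f.flip`. So when the odd part vanishes, `evenPart` is the
sum of the two chain subspaces of `f`, hence invariant. Its two-sided radical is zero, so `ndegPart`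
is invariant too, and `L f` splits as a product (`nonempty_lieEquiv`). Reductivity passes to
products and to factors.

An odd block excludes reductivity. For an invariant subspace `W`, the maps sending `V` into `W` and
killing `W` form an abelian ideal, central if `L f` is reductive. For `J_1`, taking `W` to be the
two-sided radical gives a non-central element; for odd `n ≥ 3`, taking `W` to be the chain subspace
does (`not_isReductive_of_odd`). -/

namespace FormLie

universe u

/-! ### Solvable ideals and reductivity under maps and products. -/

section LieGeneral

variable {F : Type*} [CommRing F] {L₁ L₂ : Type*} [LieRing L₁] [LieAlgebra F L₁] [LieRing L₂]
  [LieAlgebra F L₂]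

theorem mem_lieCenter_iff (x : L₁) : x ∈ LieAlgebra.center F L₁ ↔ ∀ y : L₁, ⁅y, x⁆ = 0 :=
  LieModule.mem_maxTrivSubmodule F L₁ L₁ x

theorem isSolvable_of_injOn (I : LieIdeal F L₁) (J : LieIdeal F L₂)
    (hJ : LieAlgebra.IsSolvable J) (φ : L₁ →ₗ⁅F⁆ L₂) (hφ : ∀ x ∈ I, φ x ∈ J)
    (hinj : ∀ x ∈ I, φ x = 0 → x = 0) : LieAlgebra.IsSolvable I := by
  let ψ : I →ₗ⁅F⁆ J :=
    { toFun := fun x => ⟨φ x, hφ x x.2⟩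
      map_add' := fun x y => by ext; simp
      map_smul' := fun c x => by ext; simp
      map_lie' := fun {x y} => by ext; simp }
  refine Function.Injective.lieAlgebra_isSolvable (R := F) (f := ψ) ?_
  refine (injective_iff_map_eq_zero ψ).2 fun x hx => ?_
  exact Subtype.ext (hinj x x.2 (congrArg Subtype.val hx))

theorem isSolvable_map (I : LieIdeal F L₁) (hI : LieAlgebra.IsSolvable I) (φ : L₁ →ₗ⁅F⁆ L₂)
    (hφ : Function.Surjective φ) : LieAlgebra.IsSolvable (I.map φ) := by
  have hmem : ∀ x : I, φ x ∈ I.map φ := fun x => LieIdeal.mem_map x.2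
  let ψ : I →ₗ⁅F⁆ I.map φ :=
    { toFun := fun x => ⟨φ x, hmem x⟩
      map_add' := fun x y => by ext; simp
      map_smul' := fun c x => by ext; simp
      map_lie' := fun {x y} => by ext; simp }
  refine Function.Surjective.lieAlgebra_isSolvable (R := F) (f := ψ) ?_
  rintro ⟨y, hy⟩
  obtain ⟨x, hx⟩ := LieIdeal.mem_map_of_surjective hφ hy
  exact ⟨x, Subtype.ext hx⟩

theorem IsReductive.of_lieEquiv (e : L₁ ≃ₗ⁅F⁆ L₂) (h : IsReductive F L₁) : IsReductive F L₂ := by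
  intro J hJ y hy
  have hs : LieAlgebra.IsSolvable (J.comap e.toLieHom) :=
    isSolvable_of_injOn _ J hJ e.toLieHom (fun x hx => by simpa using hx)
      (fun x _ hx => e.injective (by simpa using hx))
  have hz := h _ hs (show e.symm y ∈ J.comap e.toLieHom by simpa using hy)
  rw [mem_lieCenter_iff] at hz ⊢
  intro z
  have h1 : ⁅z, y⁆ = e ⁅e.symm z, e.symm y⁆ := by
    have : e ⁅e.symm z, e.symm y⁆ = ⁅e (e.symm z), e (e.symm y)⁆ := e.toLieHom.map_lie _ _
    rw [this, e.apply_symm_apply, e.apply_symm_apply]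
  rw [h1, hz]
  exact e.toLieHom.map_zero

theorem IsReductive.prod (h₁ : IsReductive F L₁) (h₂ : IsReductive F L₂) :
    IsReductive F (L₁ × L₂) := by
  intro I hI y hy
  have a₁ := h₁ _ (isSolvable_map I hI (LieHom.fst F L₁ L₂) LieHom.fst_surjective)
    (LieIdeal.mem_map hy)
  have a₂ := h₂ _ (isSolvable_map I hI (LieHom.snd F L₁ L₂) LieHom.snd_surjective)
    (LieIdeal.mem_map hy)
  rw [mem_lieCenter_iff] at a₁ a₂ ⊢
  intro z
  exact Prod.ext (a₁ z.1) (a₂ z.2)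

/-- A solvable ideal `I` of `L₁` gives the solvable ideal `I × 0` of the product, written as a
preimage cut with the kernel of the second projection. -/
theorem IsReductive.prod_left (h : IsReductive F (L₁ × L₂)) : IsReductive F L₁ := by
  intro I hI y hy
  have hs : LieAlgebra.IsSolvable
      (I.comap (LieHom.fst F L₁ L₂) ⊓ (LieHom.snd F L₁ L₂).ker : LieIdeal F (L₁ × L₂)) := by
    refine isSolvable_of_injOn _ I hI (LieHom.fst F L₁ L₂) (fun x hx => by simpa using hx.1) ?_
    exact fun x hx h0 => Prod.ext h0 (by simpa using hx.2)
  have hz := h _ hs (show (y, (0 : L₂)) ∈ _ from ⟨by simpa using hy, by simp⟩)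
  rw [mem_lieCenter_iff] at hz ⊢
  exact fun z => congrArg Prod.fst (hz (z, 0))

theorem IsReductive.prod_right (h : IsReductive F (L₁ × L₂)) : IsReductive F L₂ :=
  (h.of_lieEquiv (LieEquiv.prodComm F L₁ L₂)).prod_left

/-- An element of an ideal that is an eigenvector of eigenvalue `2` of one of its own multiples
obstructs solvability. -/
theorem not_isSolvable_of_lie_lie (h2 : IsUnit (2 : F)) (I : LieIdeal F L₁) {e g : L₁}
    -- Since `e` is half of `⁅⁅e, g⁆, e⁆`, it survives into every term of the derived series.
    (he : e ∈ I) (he0 : e ≠ 0) (hge : ⁅⁅e, g⁆, e⁆ = (2 : F) • e) : ¬ LieAlgebra.IsSolvable I := by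
  intro hs
  obtain ⟨k, hk⟩ := (LieAlgebra.isSolvable_iff F I).1 hs
  rw [LieIdeal.derivedSeries_eq_bot_iff] at hk
  have key : ∀ k, e ∈ LieAlgebra.derivedSeriesOfIdeal F L₁ k I := by
    intro k
    induction k with
    | zero => exact he
    | succ k ih =>
      rw [LieAlgebra.derivedSeriesOfIdeal_succ]
      have h1 : ⁅⁅e, g⁆, e⁆ ∈ ⁅LieAlgebra.derivedSeriesOfIdeal F L₁ k I,
          LieAlgebra.derivedSeriesOfIdeal F L₁ k I⁆ :=
        LieSubmodule.lie_mem_lie (lie_mem_left F L₁ _ _ _ ih) ih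
      rw [hge] at h1
      obtain ⟨u, hu⟩ := h2
      have h3 := SMulMemClass.smul_mem (↑u⁻¹ : F) h1
      rwa [smul_smul, ← hu, Units.inv_mul, one_smul] at h3
  have := key k
  rw [hk] at this
  exact he0 (by simpa using this)

theorem IsReductive.lie_eq_zero (h : IsReductive F L₁) (I : LieIdeal F L₁)
    (hI : ∀ x ∈ I, ∀ y ∈ I, ⁅x, y⁆ = 0) {x : L₁} (hx : x ∈ I) (y : L₁) : ⁅y, x⁆ = 0 := by
  have : IsLieAbelian I := ⟨fun a b => Subtype.ext (hI a a.2 b b.2)⟩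
  exact (mem_lieCenter_iff x).1 (h I (LieAlgebra.ofAbelianIsSolvable I) hx) y

end LieGeneral

/-! ### Reductivity of `gl(V)` and a double annihilator argument. -/

section Linear

variable {F : Type*} {V : Type*} [Field F] [AddCommGroup V] [Module F V]

theorem exists_dual_pair {v u : V} (hu : u ∉ Submodule.span F {v}) :
    ∃ φ : Module.Dual F V, φ v = 0 ∧ φ u = 1 := by
  obtain ⟨φ, hφ, h0⟩ := Submodule.exists_dual_map_eq_bot_of_notMem hu inferInstance
  have hv0 : φ v = 0 := by
    have : φ v ∈ (Submodule.span F {v}).map φ :=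
      Submodule.mem_map_of_mem (Submodule.mem_span_singleton_self v)
    simpa [h0] using this
  exact ⟨(φ u)⁻¹ • φ, by simp [hv0], by simp [hφ]⟩

theorem commute_of_forall_mem_span (x : Module.End F V) (h : ∀ v, x v ∈ Submodule.span F {v})
    (y : Module.End F V) : ⁅y, x⁆ = 0 := by
  obtain ⟨a, rfl⟩ := LinearMap.exists_eq_smul_id_of_forall_notLinearIndependent (f := x) (by
    intro v hli
    obtain ⟨a, ha⟩ := Submodule.mem_span_singleton.1 (h v)
    have := LinearIndependent.pair_iff.1 hli a (-1) (by simp [ha])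
    simpa using this.2)
  ext v
  simp [LieRing.of_associative_ring_bracket]

/-- A non-scalar `x` moves some `v` off its line. The rank one map `e = φ ⊗ v` with `φ v = 0`, `φ (x
v) = 1` satisfies `⁅e, ⁅e, x⁆⁆ = -2e`, so it lies in every ideal containing `x`; with `g = ψ ⊗ x v`
it generates a copy of the `sl₂` relation `⁅⁅e, g⁆, e⁆ = 2e`. -/
theorem isReductive_end (h2 : (2 : F) ≠ 0) : IsReductive F (Module.End F V) := by
  intro I hI x hx
  rw [mem_lieCenter_iff]
  by_contra hc
  have : ∃ v, x v ∉ Submodule.span F {v} := by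
    by_contra! h
    exact hc (commute_of_forall_mem_span x h)
  obtain ⟨v, hv⟩ := this
  have hv0 : v ≠ 0 := by rintro rfl; simp at hv
  obtain ⟨φ, hφv, hφu⟩ := exists_dual_pair hv
  have hvu : v ∉ Submodule.span F {x v} := by
    intro h
    obtain ⟨a, ha⟩ := Submodule.mem_span_singleton.1 h
    have := congrArg φ ha
    simp only [map_smul, hφu, hφv, smul_eq_mul, mul_one] at this
    rw [this, zero_smul] at ha
    exact hv0 ha.symm
  obtain ⟨ψ, -, hψv⟩ := exists_dual_pair hvu
  let e : Module.End F V := φ.smulRight v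
  let g : Module.End F V := ψ.smulRight (x v)
  have he : e ∈ I := by
    have h1 : ⁅e, ⁅e, x⁆⁆ ∈ I := lie_mem_right F _ I _ _ (lie_mem_right F _ I _ _ hx)
    have h3 : ⁅e, ⁅e, x⁆⁆ = (-2 : F) • e := by
      ext w
      simp [LieRing.of_associative_ring_bracket, e, hφv, hφu, two_smul]
      module
    rw [h3] at h1
    have h4 := SMulMemClass.smul_mem (-2 : F)⁻¹ h1
    rwa [smul_smul, inv_mul_cancel₀ (neg_ne_zero.2 h2), one_smul] at h4
  refine not_isSolvable_of_lie_lie (h2.isUnit) I (g := g) he ?_ ?_ hI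
  · intro h
    have := LinearMap.congr_fun h (x v)
    simp [e, hφu, hv0] at this
  · ext w
    simp [LieRing.of_associative_ring_bracket, e, g, hφv, hφu, hψv, two_smul]

/-- A functional vanishing on the common kernel of the functionals in the range of `T` lies in
the range of `T`. -/
theorem exists_apply_eq_of_forall {X : Type*} [AddCommGroup X] [Module F X]
    [FiniteDimensional F V] (T : X →ₗ[F] Module.Dual F V) (g : Module.Dual F V)
    (h : ∀ m, (∀ x, T x m = 0) → g m = 0) : ∃ x, T x = g := by
  have : g ∈ (LinearMap.range T).dualCoannihilator.dualAnnihilator := by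
    rw [Submodule.mem_dualAnnihilator]
    intro m hm
    rw [Submodule.mem_dualCoannihilator] at hm
    exact h m fun x => hm _ ⟨x, rfl⟩
  rwa [Subspace.dualCoannihilator_dualAnnihilator_eq] at this

end Linear

/-! ### Splitting a nilpotent Jordan block off a degenerate form. -/

section Gabriel

variable {F : Type*} {V : Type*} [Field F] [AddCommGroup V] [Module F V]

/-- Vectors `v 0, …, v n` with Gram matrix `J_{n+1}` which span an orthogonal summand. -/
structure IsJordanSystem (f : BilinForm F V) (n : ℕ) (v : ℕ → V) : Prop where
  left : ∀ x, f (v 0) x = 0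
  right : ∀ x, f x (v n) = 0
  shift : ∀ j, j + 2 ≤ n → ∀ x, f (v (j + 2)) x = f x (v j)
  gram : ∀ i j, i ≤ n → j ≤ n → f (v i) (v j) = if i = j + 1 then 1 else 0

/-- The left orthogonal of the left radical. -/
def leftPerpRadical (f : BilinForm F V) : Submodule F V where
  carrier := {m | ∀ l, f l = 0 → f m l = 0}
  zero_mem' := by simp
  add_mem' := by
    intro a b ha hb l hl
    simp [ha l hl, hb l hl]
  smul_mem' := by
    intro c a ha l hl
    simp [ha l hl]

variable [FiniteDimensional F V]

theorem exists_left_radical_eq (f : BilinForm F V) (g : Module.Dual F V)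
    (hg : ∀ m ∈ leftPerpRadical f, g m = 0) : ∃ l, f l = 0 ∧ ∀ x, f x l = g x := by
  obtain ⟨l, hl⟩ := exists_apply_eq_of_forall (f.flip ∘ₗ (LinearMap.ker f).subtype) g
    (fun m hm => hg m fun l hl => hm ⟨l, hl⟩)
  exact ⟨l, l.2, fun x => LinearMap.congr_fun hl x⟩

theorem exists_eq_on_left_radical (f : BilinForm F V) (φ : Module.Dual F V)
    (hφ : ∀ l, f l = 0 → (∀ x, f x l = 0) → φ l = 0) : ∃ c, ∀ l, f l = 0 → f c l = φ l := by
  obtain ⟨c, hc⟩ := exists_apply_eq_of_forall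
    ((LinearMap.ker f).subtype.dualMap ∘ₗ f) (φ ∘ₗ (LinearMap.ker f).subtype)
    (fun m hm => hφ m m.2 fun x => hm x)
  exact ⟨c, fun l hl => LinearMap.congr_fun hc ⟨l, hl⟩⟩

theorem exists_eq_on_submodule (f : BilinForm F V) (M : Submodule F V) (g : Module.Dual F V)
    (hg : ∀ m ∈ M, (∀ x ∈ M, f m x = 0) → g m = 0) : ∃ m ∈ M, ∀ x ∈ M, f x m = g x := by
  obtain ⟨m, hm⟩ := exists_apply_eq_of_forall (f.restrict M).flip (g ∘ₗ M.subtype)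
    (fun m h => hg m m.2 fun x hx => h ⟨x, hx⟩)
  exact ⟨m, m.2, fun x hx => LinearMap.congr_fun hm ⟨x, hx⟩⟩

end Gabriel

section Step

variable {F : Type*} {V : Type*} [Field F] [AddCommGroup V] [Module F V] [FiniteDimensional F V]

/-- A system `w` on the left orthogonal `M` of the left radical becomes `v₀, c, w 0 + l 0, …, w n +
l n` on `V`. Adding an `l` from the left radical leaves `f(w k, ·)` and all values `f(M, w k)`
unchanged, but alters `f(·, w k)` by any prescribed functional vanishing on `M`. -/
theorem IsJordanSystem.extend {f : BilinForm F V} {φ : Module.Dual F V} {n : ℕ}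
    {w : ℕ → leftPerpRadical f} (hw : IsJordanSystem (f.restrict (leftPerpRadical f)) n w)
    {c l₀ : V} (hl₀ : f l₀ = 0) (hφ : φ l₀ = 1) (hc : ∀ l, f l = 0 → f c l = φ l)
    (hw0 : f (w 0) c = 1) (hcc : n = 0 → f c c = 0)
    (hw1 : 1 ≤ n → ∀ x, f (w 1) x = f x c) :
    ∃ (n : ℕ) (v : ℕ → V), IsJordanSystem f n v ∧ φ (v 0) = 1 ∧
      (1 ≤ n → ∀ l, f l = 0 → φ l = f (v 1) l) := by
  have hM : ∀ (m : leftPerpRadical f) l, f l = 0 → f m l = 0 := fun m => m.2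
  have gram : ∀ i j, i ≤ n → j ≤ n → f (w i) (w j) = if i = j + 1 then 1 else 0 := hw.gram
  obtain ⟨v₀, hv₀, hv₀'⟩ := exists_left_radical_eq f (f (w 0)) (fun m hm => hw.left ⟨m, hm⟩)
  have hl : ∀ k, ∃ l, f l = 0 ∧ (k = n → ∀ x, f x (w k + l) = 0) ∧
      (k + 2 ≤ n → ∀ x, f x (w k + l) = f (w (k + 2)) x) ∧ (k + 1 = n → f c (w k + l) = 0) := by
    intro k
    -- For `k + 2 ≤ n` the correction gives the shift relation and for `k = n` right vanishing. For
    -- `k + 1 = n` only `f(c, ·)` must vanish, and `f(c, l₀) = 1` allows a multiple of `l₀`.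
    rcases lt_trichotomy (k + 1) n with h | h | h
    · obtain ⟨l, hl, hl'⟩ := exists_left_radical_eq f (f (w (k + 2)) - f.flip (w k))
        (fun m hm => by
          have := hw.shift k h ⟨m, hm⟩
          simpa [sub_eq_zero] using this)
      exact ⟨l, hl, by omega, fun _ x => by simp [hl'], by omega⟩
    · refine ⟨(-f c (w k)) • l₀, by simp [hl₀], by omega, by omega, fun _ => ?_⟩
      simp [hc _ hl₀, hφ]
    · by_cases hk : k = n
      · obtain ⟨l, hl, hl'⟩ := exists_left_radical_eq f (-f.flip (w k))
          (fun m hm => by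
            have := hw.right ⟨m, hm⟩
            rw [← hk] at this
            simpa using this)
        exact ⟨l, hl, fun _ x => by simp [hl'], by omega, by omega⟩
      · exact ⟨0, by simp, by omega, by omega, by omega⟩
  choose l hl0 hln hlk hlc using hl
  have hwl : ∀ k x, f (w k + l k) x = f (w k) x := fun k x => by simp [hl0]
  let v : ℕ → V := fun i => match i with
    | 0 => v₀
    | 1 => c
    | k + 2 => w k + l k
  refine ⟨n + 2, v, ⟨?_, hln n rfl, ?_, ?_⟩, ?_, fun _ l hl => (hc l hl).symm⟩
  · intro x
    simp [v, hv₀]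
  · rintro (_ | _ | k) hk x
    · exact (hwl 0 x).trans (hv₀' x).symm
    · exact (hwl 1 x).trans (hw1 (by omega) x)
    · exact (hwl (k + 2) x).trans (hlk k (by omega) x).symm
  · rintro (_ | _ | i) (_ | _ | j) hi hj
    · simp [v, hv₀]
    · simp [v, hv₀]
    · simp [v, hv₀]
    · simp [v, hv₀', hw0]
    · change f c c = _
      rcases Nat.eq_zero_or_pos n with h | h
      · simp [hcc h]
      · have h1 := hw1 h c
        have h2 := hw1 h (w 1)
        rw [gram 1 1 h h] at h2
        rw [← h1, ← h2]
    · change f c (w j + l j) = _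
      rw [if_neg (by omega)]
      rcases lt_trichotomy (j + 1) n with h | h | h
      · rw [hlk j h, ← hw1 (by omega), gram _ _ (by omega) h, if_neg (by omega)]
      · exact hlc j h
      · exact hln j (by omega) c
    · change f (w i + l i) v₀ = _
      rw [hv₀', map_add, hM _ _ (hl0 i), gram _ _ (by omega) (by omega), if_neg (by omega),
        if_neg (by omega), add_zero]
    · change f (w i + l i) c = _
      rw [hwl]
      rcases Nat.eq_zero_or_pos i with h | h
      · simp [h, hw0]
      · rw [← hw1 (by omega), gram _ _ (by omega) (by omega), if_neg (by omega),
          if_neg (by omega)]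
    · change f (w i + l i) (w j + l j) = _
      rw [hwl, map_add, hM _ _ (hl0 j), gram _ _ (by omega) (by omega), add_zero]
      simp
  · change φ v₀ = 1
    rw [← hc _ hv₀, hv₀', hw0]

end Step

/-- Induction on dimension, passing from `V` to the left orthogonal `M` of the left radical and
lengthening the block by two. The clause on `f (v 1)` is what lets the inductive step adjust `c`. -/
theorem exists_isJordanSystem {F : Type*} [Field F] (d : ℕ) : ∀ (V : Type u) [AddCommGroup V]
    [Module F V] [FiniteDimensional F V] (f : BilinForm F V) (φ : Module.Dual F V) (l₀ : V),
    Module.finrank F V = d → f l₀ = 0 → φ l₀ = 1 →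
    ∃ (n : ℕ) (v : ℕ → V), IsJordanSystem f n v ∧ φ (v 0) = 1 ∧
      (1 ≤ n → ∀ l, f l = 0 → φ l = f (v 1) l) := by
  induction d using Nat.strong_induction_on with
  | _ d ih =>
  intro V _ _ _ f φ l₀ hd hl₀ hφ
  by_cases hrad : ∀ l, f l = 0 → (∀ x, f x l = 0) → φ l = 0
  swap
  -- A vector of the two-sided radical outside `ker φ` spans a block `J_1`.
  · push Not at hrad
    obtain ⟨l, hl, hl', hl0⟩ := hrad
    refine ⟨0, fun _ => (φ l)⁻¹ • l, ⟨?_, ?_, by omega, ?_⟩, ?_, by omega⟩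
    · simp [hl]
    · simp [hl']
    · simp [hl]
    · simp [hl0]
  obtain ⟨c, hc⟩ := exists_eq_on_left_radical f φ hrad
  by_cases hcM : ∀ m ∈ leftPerpRadical f, (∀ x ∈ leftPerpRadical f, f m x = 0) → f m c = 0
  -- Here `c` can be corrected by `m ∈ M` and a left radical vector so that `f(·, c) = 0`, which
  -- yields a block `J_2`.
  · obtain ⟨m, hm, hmx⟩ := exists_eq_on_submodule f _ (f.flip c) hcM
    obtain ⟨l, hl, hlx⟩ := exists_left_radical_eq f (f.flip (c - m)) (fun x hx => by
      have := hmx x hx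
      simp at this
      simp [this])
    have hlx' : ∀ x, f x l = f x c - f x m := by simpa using hlx
    have hv1 : ∀ l', f l' = 0 → f (c - m - l) l' = φ l' := fun l' hl' => by
      simp [hl, hc _ hl', hm l' hl']
    have hv1' : ∀ x, f x (c - m - l) = 0 := fun x => by simp [hlx']
    refine ⟨1, fun i => if i = 0 then l₀ else c - m - l, ⟨?_, ?_, by omega, ?_⟩, ?_, ?_⟩
    · simp [hl₀]
    · exact hv1'
    · intro i j hi hj
      interval_cases i <;> interval_cases j
      · simp [hl₀]
      · simp [hl₀]
      · simpa [hφ] using hv1 _ hl₀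
      · simpa only [if_neg one_ne_zero, Nat.reduceAdd, OfNat.one_ne_ofNat, if_false] using hv1' _
    · simpa using hφ
    · exact fun _ l' hl' => (hv1 l' hl').symm
  · push Not at hcM
    obtain ⟨m, hm, hmM, hmc⟩ := hcM
    have hlt : Module.finrank F (leftPerpRadical f) < d := by
      rw [← hd]
      refine Submodule.finrank_lt fun h => ?_
      have : c ∈ leftPerpRadical f := h ▸ Submodule.mem_top
      have := this l₀ hl₀
      rw [hc _ hl₀, hφ] at this
      exact one_ne_zero this
    obtain ⟨n, w, hw, hw0, hw1⟩ := ih _ hlt (leftPerpRadical f)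
      (f.restrict (leftPerpRadical f)) (f.flip c ∘ₗ (leftPerpRadical f).subtype)
      ((f m c)⁻¹ • ⟨m, hm⟩) rfl
      (by ext x; simp [hmM x x.2])
      (by simp [hmc])
    have hw0' : f (w 0) c = 1 := hw0
    rcases Nat.eq_zero_or_pos n with hn | hn
    · refine hw.extend (c := c + (-f c c) • l₀) hl₀ hφ ?_ ?_ ?_ (by omega)
      · intro l hl
        simp [hc l hl, hl₀]
      · simp [hw0', (w 0).2 l₀ hl₀]
      · simp [hc _ hl₀, hφ, hl₀]
    -- By the inductive clause, `f(w 1, ·) - f(·, c)` kills the left radical of `f` on `M`. Hence it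
    -- is `f(·, m')` on `M`, and a left radical vector corrects the rest.
    · have hw1' : ∀ l ∈ leftPerpRadical f, (∀ x ∈ leftPerpRadical f, f l x = 0) →
          f l c = f (w 1) l := fun l hl hl' =>
        hw1 hn ⟨l, hl⟩ (LinearMap.ext fun x => hl' x x.2)
      obtain ⟨m', hm', hmx⟩ := exists_eq_on_submodule f (leftPerpRadical f)
        (f (w 1) - f.flip c)
        (fun l hl hl' => by simp [hw1' l hl hl'])
      replace hmx : ∀ x ∈ leftPerpRadical f, f x m' = f (w 1) x - f x c := hmx
      obtain ⟨l, hl, hlx⟩ := exists_left_radical_eq f (f (w 1) - f.flip (c + m'))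
        (fun x hx => by simp [hmx x hx])
      replace hlx : ∀ x, f x l = f (w 1) x - f x (c + m') := hlx
      have key : ∀ x, f x (c + m' + l) = f (w 1) x := fun x => by
        rw [map_add, hlx]; ring
      refine hw.extend (c := c + m' + l) hl₀ hφ ?_ ?_ (by omega) (fun _ x => (key x).symm)
      · intro l' hl'
        simp [hc l' hl', hl, hm' l' hl']
      · rw [key]
        simpa using hw.gram 1 0 hn (by omega)

section Degenerate

variable {F : Type*} {V : Type*} [Field F] [AddCommGroup V] [Module F V] [FiniteDimensional F V]

/-- An indecomposable bilinear form with nonzero left radical is given by a nilpotent Jordan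
block. -/
theorem Indecomposable.exists_hasGramMatrix {f : BilinForm F V} (hf : Indecomposable f) {l₀ : V}
    (hl₀ : f l₀ = 0) (h0 : l₀ ≠ 0) : ∃ n, HasGramMatrix f (J F n) := by
  obtain ⟨φ, hφ⟩ : ∃ φ : Module.Dual F V, φ l₀ = 1 := by
    obtain ⟨φ, -, h⟩ := exists_dual_pair (F := F) (v := 0) (u := l₀) (by simpa using h0)
    exact ⟨φ, h⟩
  obtain ⟨n, v, hv, hv0, -⟩ := exists_isJordanSystem _ V f φ l₀ rfl hl₀ hφ
  -- These functionals are dual to the `v j`. By the shift relation their common kernel is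
  -- orthogonal on both sides to the span of the `v j`.
  let g : Fin (n + 1) → Module.Dual F V := fun i =>
    if (i : ℕ) = 0 then (if n = 0 then φ else f (v 1)) else f.flip (v (i - 1))
  have hg : ∀ i j : Fin (n + 1), g i (v j) = if i = j then 1 else 0 := by
    intro i j
    have hi := i.2
    have hj := j.2
    simp only [g, Fin.ext_iff]
    split_ifs with h1 h2 h3 h3 h3
    · rw [← h3, h1, hv0]
    · omega
    · rw [hv.gram _ _ (by omega) (by omega), if_pos (by omega)]
    · rw [hv.gram _ _ (by omega) (by omega), if_neg (by omega)]
    · change f (v j) (v (i - 1)) = _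
      rw [hv.gram _ _ (by omega) (by omega), if_pos (by omega)]
    · change f (v j) (v (i - 1)) = _
      rw [hv.gram _ _ (by omega) (by omega), if_neg (by omega)]
  let T : V →ₗ[F] (Fin (n + 1) → F) := LinearMap.pi g
  let S : (Fin (n + 1) → F) →ₗ[F] V := Fintype.linearCombination F fun i => v i
  have hTS : T ∘ₗ S = LinearMap.id := by
    refine LinearMap.pi_ext' fun j => LinearMap.ext_ring (funext fun i => ?_)
    simp [T, S, Fintype.linearCombination_apply_single, hg, Pi.single_apply]
  have hTS' : ∀ c, T (S c) = c := LinearMap.congr_fun hTS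
  have hcompl : IsCompl (LinearMap.range S) (LinearMap.ker T) := by
    refine ⟨Submodule.disjoint_def.2 ?_, Submodule.codisjoint_iff_exists_add_eq.2 fun x => ?_⟩
    · rintro _ ⟨c, rfl⟩ hc
      rw [LinearMap.mem_ker, hTS'] at hc
      rw [hc, map_zero]
    · exact ⟨S (T x), x - S (T x), ⟨_, rfl⟩, by simp [hTS'], by simp⟩
  have hmem : ∀ x ∈ LinearMap.ker T, ∀ i, g i x = 0 := fun x hx i => congrFun hx i
  have hR : ∀ x ∈ LinearMap.ker T, ∀ j : Fin (n + 1), f x (v j) = 0 := by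
    intro x hx j
    by_cases hj : (j : ℕ) = n
    · rw [hj, hv.right]
    · have := hmem x hx ⟨j + 1, by omega⟩
      simpa [g] using this
  have hL : ∀ x ∈ LinearMap.ker T, ∀ j : Fin (n + 1), f (v j) x = 0 := by
    rintro x hx ⟨_ | _ | j, hj⟩
    · exact hv.left x
    · have := hmem x hx 0
      simpa [g, show n ≠ 0 by omega] using this
    · have := hR x hx ⟨j, by omega⟩
      rw [hv.shift j (by omega), this]
  have horth : Orthogonal f (LinearMap.range S) (LinearMap.ker T) := by
    rintro _ ⟨c, rfl⟩ x hx
    simp only [S, Fintype.linearCombination_apply, map_sum, map_smul, LinearMap.sum_apply,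
      LinearMap.smul_apply, hR x hx, hL x hx]
    simp
  have hT : LinearMap.ker T = ⊥ := by
    refine (hf.2 _ _ hcompl horth).resolve_left fun h => ?_
    have h1 : S (Pi.single 0 1) ∈ LinearMap.range S := ⟨_, rfl⟩
    rw [h, Submodule.mem_bot] at h1
    simp only [S, Fintype.linearCombination_apply_single, one_smul, Fin.val_zero] at h1
    rw [h1, map_zero] at hv0
    exact zero_ne_one hv0
  have hST : ∀ x, S (T x) = x := fun x => by
    refine LinearMap.ker_eq_bot.1 hT ?_
    exact hTS' (T x)
  let e : V ≃ₗ[F] (Fin (n + 1) → F) :=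
    LinearEquiv.ofLinearMap T S hTS (LinearMap.ext hST)
  refine ⟨n + 1, Module.Basis.ofEquivFun e, fun i j => ?_⟩
  have he : ∀ i, Module.Basis.ofEquivFun e i = v i := fun i => by
    rw [Module.Basis.coe_ofEquivFun]
    change S _ = _
    simp [S, Fintype.linearCombination_apply_single]
  rw [he, he, hv.gram _ _ (by omega) (by omega)]
  simp [J]

end Degenerate

/-! ### The invariant isotropic subspace of chain ends. -/

section Chain

variable {F : Type*} {V : Type*} [Field F] [AddCommGroup V] [Module F V]

/-- The vectors at the end of a chain `0 = u 0, …, u k` with `f (u (i + 1)) = f.flip (u i)`. -/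
inductive IsChainEnd (f : BilinForm F V) : V → Prop
  | zero : IsChainEnd f 0
  | step (u w : V) : IsChainEnd f u → (∀ x, f w x = f x u) → IsChainEnd f w

theorem IsChainEnd.add {f : BilinForm F V} {a : V} (ha : IsChainEnd f a) :
    ∀ {b : V}, IsChainEnd f b → IsChainEnd f (a + b) := by
  induction ha with
  | zero => intro b hb; simpa using hb
  | step u w hu hw ih =>
    intro b hb
    cases hb with
    | zero => simpa using hu.step u w hw
    | step u' _ hu' hw' => exact (ih hu').step _ _ fun x => by simp [hw, hw']

theorem IsChainEnd.smul {f : BilinForm F V} {a : V} (ha : IsChainEnd f a) (c : F) :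
    IsChainEnd f (c • a) := by
  induction ha with
  | zero => simpa using IsChainEnd.zero
  | step u w hu hw ih => exact ih.step _ _ fun x => by simp [hw]

/-- The submodule of all ends of chains starting at zero. -/
def chainSubmodule (f : BilinForm F V) : Submodule F V where
  carrier := {x | IsChainEnd f x}
  zero_mem' := .zero
  add_mem' := fun ha hb => IsChainEnd.add ha hb
  smul_mem' := fun c _ h => h.smul c

theorem apply_eq_zero_of_isChainEnd {f : BilinForm F V} {a : V} (ha : IsChainEnd f a) :
    ∀ {b : V}, IsChainEnd f b → f a b = 0 := by
  induction ha with
  | zero => simp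
  | step u w hu hw ih =>
    intro b hb
    cases hb with
    | zero => simp
    | step u' _ hu' hw' => rw [hw, hw', ih hu']

/-- Moving `y` across `f` twice cancels the sign, so `y` carries chains to chains. -/
theorem IsChainEnd.map {f : BilinForm F V} {y : Module.End F V}
    (hy : ∀ v w, f (y v) w = -f v (y w)) {a : V} (ha : IsChainEnd f a) :
    IsChainEnd f (y a) := by
  induction ha with
  | zero => simpa using IsChainEnd.zero
  | step u w hu hw ih =>
    refine ih.step _ _ fun x => ?_
    rw [hy, hw, hy, neg_neg]

/-- If the predecessor `u` lies in `P`, then `f(w, ·) = f(·, u)` vanishes on `Q`, so nondegeneracy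
kills the `Q`-component of `w`. -/
theorem IsChainEnd.mem_of_isCompl {f : BilinForm F V} {P Q : Submodule F V} (hPQ : IsCompl P Q)
    (ho : Orthogonal f P Q) (hQ : ∀ q ∈ Q, (∀ q' ∈ Q, f q q' = 0) → q = 0) {a : V}
    (ha : IsChainEnd f a) : a ∈ P := by
  induction ha with
  | zero => exact P.zero_mem
  | step u w hu hw ih =>
    obtain ⟨p, q, hp, hq, rfl⟩ := Submodule.codisjoint_iff_exists_add_eq.1 hPQ.codisjoint w
    have : q = 0 := hQ q hq fun q' hq' => by
      have := hw q'
      rwa [map_add, LinearMap.add_apply, (ho p hp q' hq').1, (ho u ih q' hq').2, zero_add] at this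
    simpa [this] using hp

end Chain

/-! ### Chains and skew endomorphisms of a single Jordan block. -/

section JordanBlock

variable {F : Type*} {V : Type*} [Field F] [AddCommGroup V] [Module F V]

theorem skew_of_basis {ι : Type*} {f : BilinForm F V} (b : Module.Basis ι F V)
    (y : Module.End F V) (h : ∀ i j, f (y (b i)) (b j) = -f (b i) (y (b j))) (v w : V) :
    f (y v) w = -f v (y w) := by
  have : f ∘ₗ y = -(f.compl₂ y) := LinearMap.ext_basis b b fun i j => by simpa using h i j
  exact LinearMap.congr_fun (LinearMap.congr_fun this v) w

variable {n : ℕ} {f : BilinForm F V} (b : Module.Basis (Fin n) F V)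

theorem coord_succ_eq (hb : ∀ i j, f (b i) (b j) = J F n i j) (k : ℕ) (hk : k + 1 < n) (x : V) :
    b.coord ⟨k + 1, hk⟩ x = f x (b ⟨k, by omega⟩) := by
  have : b.coord ⟨k + 1, hk⟩ = f.flip (b ⟨k, by omega⟩) := b.ext fun i => by
    simp [hb, J, Finsupp.single_apply, Fin.ext_iff]
  exact LinearMap.congr_fun this x

theorem coord_eq_succ (hb : ∀ i j, f (b i) (b j) = J F n i j) (k : ℕ) (hk : k + 1 < n) (x : V) :
    b.coord ⟨k, by omega⟩ x = f (b ⟨k + 1, hk⟩) x := by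
  have : b.coord ⟨k, by omega⟩ = f (b ⟨k + 1, hk⟩) := b.ext fun i => by
    simp [hb, J, Finsupp.single_apply, Fin.ext_iff, eq_comm]
  exact LinearMap.congr_fun this x

theorem isChainEnd_of_even (hb : ∀ i j, f (b i) (b j) = J F n i j) (k : ℕ) (hk : k < n)
    (hk2 : Even k) : IsChainEnd f (b ⟨k, hk⟩) := by
  induction k using Nat.twoStepInduction with
  | zero =>
    refine .step 0 _ .zero fun x => ?_
    have : f (b ⟨0, hk⟩) = 0 := b.ext fun j => by simp [hb, J]
    simp [this]
  | one => simp at hk2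
  | more k ih _ =>
    refine .step _ _ (ih (by omega) (by simpa [Nat.even_add] using hk2)) fun x => ?_
    rw [← coord_eq_succ b hb (k + 1) hk, coord_succ_eq b hb k]

theorem gram_flip_reindex_rev (hb : ∀ i j, f (b i) (b j) = J F n i j) (i j : Fin n) :
    f.flip (b.reindex Fin.revPerm i) (b.reindex Fin.revPerm j) = J F n i j := by
  have hi := i.2
  have hj := j.2
  simp only [Module.Basis.reindex_apply, Fin.revPerm_symm, Fin.revPerm_apply,
    LinearMap.BilinForm.flip_apply, hb, J, Matrix.of_apply, Fin.val_rev]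
  congr 1
  exact propext (by omega)

/-- Basis vectors of even index are chain ends for `f`. Reversing the basis gives Gram matrix `J_n`
for `f.flip` and, `n` being even, exchanges parities, so those of odd index are chain ends for
`f.flip`. -/
theorem chainSubmodule_sup_flip (h : HasGramMatrix f (J F n)) (hn : Even n) :
    chainSubmodule f ⊔ chainSubmodule f.flip = ⊤ := by
  obtain ⟨b, hb⟩ := h
  rw [eq_top_iff, ← b.span_eq, Submodule.span_le]
  rintro _ ⟨i, rfl⟩
  have hi := i.2
  rcases Nat.even_or_odd i with he | ho
  · exact Submodule.mem_sup_left (isChainEnd_of_even b hb i i.2 he)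
  · refine Submodule.mem_sup_right ?_
    have h1 : IsChainEnd f.flip (b.reindex Fin.revPerm i.rev) :=
      isChainEnd_of_even _ (gram_flip_reindex_rev b hb) i.rev i.rev.2 (by
        rw [Fin.val_rev, Nat.even_sub (by omega)]
        simp [hn, ho])
    rwa [Module.Basis.reindex_apply, Fin.revPerm_symm, Fin.revPerm_apply, Fin.rev_rev] at h1

theorem eq_zero_of_hasGramMatrix (h : HasGramMatrix f (J F n)) (hn : n ≠ 1) {c : V}
    (hl : ∀ u, f c u = 0) (hr : ∀ u, f u c = 0) : c = 0 := by
  obtain ⟨b, hb⟩ := h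
  refine b.ext_elem fun i => ?_
  rw [map_zero, Finsupp.zero_apply]
  obtain ⟨_ | k, hi⟩ := i
  · exact (coord_eq_succ b hb 0 (by omega) c).trans (hr _)
  · exact (coord_succ_eq b hb k hi c).trans (hl _)

/-- For `n` odd, `n ≥ 3`, the algebra `L(J_n)` contains a non-central element with image in the
span of the chain ends. -/
theorem exists_skew_not_commute (h : HasGramMatrix f (J F n)) (hn : Odd n) (hn1 : n ≠ 1)
    (h2 : (2 : F) ≠ 0) : ∃ h x : Module.End F V, (∀ v w, f (h v) w = -f v (h w)) ∧
      (∀ v w, f (x v) w = -f v (x w)) ∧ (∀ v, x v ∈ chainSubmodule f) ∧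
      ∃ v, h (x v) ≠ x (h v) := by
  obtain ⟨b, hb⟩ := h
  let w : ℕ → V := fun k => if hk : k < n then b ⟨k, hk⟩ else 0
  have hw : ∀ i : Fin n, w i = b i := fun i => by simp [w]
  have hg : ∀ i j, f (w i) (w j) = if i = j + 1 ∧ i < n then 1 else 0 := by
    intro i j
    by_cases hi : i < n <;> by_cases hj : j < n
    · simp [w, hi, hj, hb, J]
    · simp [w, hi, hj]; omega
    · simp [w, hi]
    · simp [w, hi]
  -- Since `n` is odd, `i + 1 < n` for every odd `i < n`. The image of `x` is fixed by `h` while `h`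
  -- negates odd vectors, so `h x = x` and `x h = -x`.
  let x : Module.End F V := b.constr F fun i =>
    if Odd (i : ℕ) then w (i + 1) - w (i - 1) else 0
  let h : Module.End F V := b.constr F fun i => ((-1 : F) ^ (i : ℕ)) • b i
  have hx : ∀ i : Fin n, x (b i) = if Odd (i : ℕ) then w (i + 1) - w (i - 1) else 0 :=
    fun i => b.constr_basis F _ i
  have hh : ∀ i : Fin n, h (b i) = ((-1 : F) ^ (i : ℕ)) • b i :=
    fun i => b.constr_basis F _ i
  refine ⟨h, x, skew_of_basis b h fun i j => ?_, skew_of_basis b x fun i j => ?_, fun v => ?_,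
    b ⟨1, by grind⟩, ?_⟩
  · rw [hh, hh, map_smul, map_smul, LinearMap.smul_apply, hb]
    simp only [J, Matrix.of_apply, smul_eq_mul]
    split_ifs with hij
    · rw [hij, pow_succ]; ring
    · simp
  · have hi := i.2
    have hj := j.2
    rw [hx, hx, ← hw, ← hw]
    by_cases hi2 : Odd (i : ℕ) <;> by_cases hj2 : Odd (j : ℕ) <;>
      simp only [hi2, hj2, if_true, if_false, map_sub, LinearMap.sub_apply, hg, map_zero,
        LinearMap.zero_apply, neg_zero]
    · grind
    · grind
    · grind
  · have : x = (chainSubmodule f).subtype ∘ₗ b.constr F fun i : Fin n =>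
        (if hi : Odd (i : ℕ) then
          ⟨b ⟨i + 1, by grind⟩, isChainEnd_of_even b hb _ _ hi.add_one⟩ -
          ⟨b ⟨i - 1, by omega⟩, isChainEnd_of_even b hb _ _ (by grind)⟩
          else 0 : chainSubmodule f) := b.ext fun i => by
      rw [hx, LinearMap.comp_apply, Module.Basis.constr_basis]
      split_ifs with hi
      · have h1 : (i : ℕ) + 1 < n := by grind
        have h3 : (i : ℕ) - 1 < n := by omega
        simp [w, h1, h3]
      · simp
    rw [this]
    exact Subtype.coe_prop _
  · have h3 : 2 < n := by grind
    have e1 : x (b ⟨1, by omega⟩) = b ⟨2, h3⟩ - b ⟨0, by omega⟩ := by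
      rw [hx]
      simp [w, h3, show 0 < n by omega]
    rw [hh, map_smul, e1, map_sub, hh, hh]
    intro h
    have := congrArg (b.coord ⟨2, h3⟩) h
    simp at this
    apply h2
    linear_combination this

end JordanBlock

/-! ### Orthogonal summands, restriction, and obstructions to reductivity. -/

section Orthogonal

variable {F : Type*} {V : Type*} [Field F] [AddCommGroup V] [Module F V] {f : BilinForm F V}
  {P Q : Submodule F V}

theorem Orthogonal.symm (ho : Orthogonal f P Q) : Orthogonal f Q P :=
  fun q hq p hp => (ho p hp q hq).symm

theorem apply_projection_right (hPQ : IsCompl P Q) (ho : Orthogonal f P Q) {p : V} (hp : p ∈ P)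
    (w : V) : f p (P.projection Q hPQ w) = f p w := by
  obtain ⟨a, b, ha, hb, rfl⟩ := Submodule.codisjoint_iff_exists_add_eq.1 hPQ.codisjoint w
  simp [Submodule.projection_apply_of_mem_left hPQ ha,
    Submodule.projection_apply_of_mem_right hPQ hb, (ho p hp b hb).1]

theorem apply_projection_left (hPQ : IsCompl P Q) (ho : Orthogonal f P Q) {p : V} (hp : p ∈ P)
    (w : V) : f (P.projection Q hPQ w) p = f w p := by
  obtain ⟨a, b, ha, hb, rfl⟩ := Submodule.codisjoint_iff_exists_add_eq.1 hPQ.codisjoint w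
  simp [Submodule.projection_apply_of_mem_left hPQ ha,
    Submodule.projection_apply_of_mem_right hPQ hb, (ho p hp b hb).2]

/-- Extension of an endomorphism of `P` by zero on the complement `Q`. -/
noncomputable def extendEnd (hPQ : IsCompl P Q) (y : Module.End F P) : Module.End F V :=
  P.subtype ∘ₗ y ∘ₗ P.projectionOnto Q hPQ

theorem extendEnd_of_mem_left (hPQ : IsCompl P Q) (y : Module.End F P) (p : P) :
    extendEnd hPQ y p = y p := by
  simp [extendEnd]

theorem extendEnd_of_mem_right (hPQ : IsCompl P Q) (y : Module.End F P) {q : V} (hq : q ∈ Q) :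
    extendEnd hPQ y q = 0 := by
  simp [extendEnd, Submodule.projectionOnto_apply_of_mem_right hPQ hq]

theorem extendEnd_mem_L (hPQ : IsCompl P Q) (ho : Orthogonal f P Q) {y : Module.End F P}
    (hy : ∀ v w, f.restrict P (y v) w = -f.restrict P v (y w)) : extendEnd hPQ y ∈ L f := by
  rw [mem_L]
  intro v w
  have h1 := hy (P.projectionOnto Q hPQ v) (P.projectionOnto Q hPQ w)
  simp only [LinearMap.BilinForm.restrict_apply, LinearMap.domRestrict_apply,
    Submodule.coe_projectionOnto_apply] at h1
  rw [apply_projection_right hPQ ho (Subtype.coe_prop _),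
    apply_projection_left hPQ ho (Subtype.coe_prop _)] at h1
  exact h1

theorem IsChainEnd.of_restrict (hPQ : IsCompl P Q) (ho : Orthogonal f P Q) {a : P}
    (ha : IsChainEnd (f.restrict P) a) : IsChainEnd f a := by
  induction ha with
  | zero => exact .zero
  | step u w hu hw ih =>
    refine ih.step _ _ fun x => ?_
    have h1 : f w (P.projection Q hPQ x) = f (P.projection Q hPQ x) u :=
      hw (P.projectionOnto Q hPQ x)
    rwa [apply_projection_right hPQ ho w.2, apply_projection_left hPQ ho u.2] at h1

/-- For `q ∈ Q`, skewness moves `x` onto `P`, which is invariant and orthogonal to `q`; so the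
`P`-component of `x q` lies in the two-sided radical of `P`. -/
theorem apply_mem_of_orthogonal (hPQ : IsCompl P Q) (ho : Orthogonal f P Q)
    (hP : ∀ p ∈ P, (∀ u ∈ P, f p u = 0) → (∀ u ∈ P, f u p = 0) → p = 0)
    {x : Module.End F V} (hx : x ∈ L f) (hxP : ∀ p ∈ P, x p ∈ P) (q : V) (hq : q ∈ Q) :
    x q ∈ Q := by
  rw [mem_L] at hx
  obtain ⟨a, b, ha, hb, hab⟩ := Submodule.codisjoint_iff_exists_add_eq.1 hPQ.codisjoint (x q)
  have h0 : a = 0 := by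
    refine hP a ha (fun u hu => ?_) fun u hu => ?_
    · have := hx q u
      rwa [← hab, (ho _ (hxP u hu) q hq).2, map_add, LinearMap.add_apply, (ho u hu b hb).2,
        add_zero, neg_zero] at this
    · have := hx u q
      rw [← hab, (ho _ (hxP u hu) q hq).1, map_add, (ho u hu b hb).1, add_zero] at this
      exact neg_eq_zero.1 this.symm
  rw [← hab, h0, zero_add]
  exact hb

/-- Restriction of the elements of `L(f)` to an invariant subspace. -/
def restrictL (hP : ∀ x ∈ L f, ∀ p ∈ P, x p ∈ P) : L f →ₗ⁅F⁆ L (f.restrict P) where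
  toFun x := ⟨x.1.restrict (hP x x.2), (mem_L _ _).2 fun v w => (mem_L _ _).1 x.2 v w⟩
  map_add' _ _ := rfl
  map_smul' _ _ := rfl
  map_lie' := rfl

theorem nonempty_lieEquiv_prod (hPQ : IsCompl P Q) (ho : Orthogonal f P Q)
    (hP : ∀ x ∈ L f, ∀ p ∈ P, x p ∈ P) (hQ : ∀ x ∈ L f, ∀ q ∈ Q, x q ∈ Q) :
    Nonempty (L f ≃ₗ⁅F⁆ L (f.restrict P) × L (f.restrict Q)) := by
  refine ⟨LieEquiv.ofBijective (LieHom.prod (restrictL hP) (restrictL hQ)) ⟨?_, ?_⟩⟩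
  · intro x y hxy
    refine Subtype.ext (LinearMap.ext fun v => ?_)
    obtain ⟨a, b, ha, hb, rfl⟩ := Submodule.codisjoint_iff_exists_add_eq.1 hPQ.codisjoint v
    have h1 := congrArg (fun z => ((z.1.1 ⟨a, ha⟩ : P) : V)) hxy
    have h2 := congrArg (fun z => ((z.2.1 ⟨b, hb⟩ : Q) : V)) hxy
    rw [map_add, map_add]
    exact congrArg₂ (· + ·) h1 h2
  · rintro ⟨y, z⟩
    refine ⟨⟨extendEnd hPQ y + extendEnd hPQ.symm z, add_mem
      (extendEnd_mem_L hPQ ho ((mem_L _ _).1 y.2))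
      (extendEnd_mem_L hPQ.symm ho.symm ((mem_L _ _).1 z.2))⟩, Prod.ext ?_ ?_⟩
    · refine Subtype.ext (LinearMap.ext fun p => Subtype.ext ?_)
      change extendEnd hPQ y p + extendEnd hPQ.symm z p = _
      rw [extendEnd_of_mem_left, extendEnd_of_mem_right _ _ p.2, add_zero]
    · refine Subtype.ext (LinearMap.ext fun q => Subtype.ext ?_)
      change extendEnd hPQ y q + extendEnd hPQ.symm z q = _
      rw [extendEnd_of_mem_left, extendEnd_of_mem_right _ _ q.2, zero_add]

/-- In a reductive `L(f)`, an element mapping `V` into an invariant subspace which it kills is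
central. -/
theorem apply_comm_of_isReductive (h : IsReductive F (L f)) (W : Submodule F V)
    (hW : ∀ y ∈ L f, ∀ w ∈ W, y w ∈ W) {x y : Module.End F V} (hx : x ∈ L f)
    (hxV : ∀ v, x v ∈ W) (hxW : ∀ w ∈ W, x w = 0) (hy : y ∈ L f) (v : V) :
    y (x v) = x (y v) := by
  let I : LieIdeal F (L f) :=
    { carrier := {x | (∀ v, x.1 v ∈ W) ∧ ∀ w ∈ W, x.1 w = 0}
      zero_mem' := by simp
      add_mem' := fun {a b} ha hb => ⟨fun v => W.add_mem (ha.1 v) (hb.1 v), fun w hw => by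
        change a.1 w + b.1 w = 0
        rw [ha.2 w hw, hb.2 w hw, add_zero]⟩
      smul_mem' := fun c a ha => ⟨fun v => W.smul_mem c (ha.1 v), fun w hw => by
        change c • a.1 w = 0
        rw [ha.2 w hw, smul_zero]⟩
      lie_mem := fun {y a} ha => ⟨fun v => W.sub_mem (hW _ y.2 _ (ha.1 v)) (ha.1 _),
        fun w hw => by
          change y.1 (a.1 w) - a.1 (y.1 w) = 0
          rw [ha.2 w hw, ha.2 _ (hW _ y.2 w hw), map_zero, sub_zero]⟩ }
  have key := h.lie_eq_zero I (fun a ha b hb => Subtype.ext (LinearMap.ext fun v => by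
    change a.1 (b.1 v) - b.1 (a.1 v) = 0
    rw [ha.2 _ (hb.1 v), hb.2 _ (ha.1 v), sub_zero])) (x := ⟨x, hx⟩) ⟨hxV, hxW⟩ ⟨y, hy⟩
  have := LinearMap.congr_fun (congrArg Subtype.val key) v
  exact sub_eq_zero.1 this

theorem eq_zero_of_isReductive_of_radical (h : IsReductive F (L f)) (hf : f ≠ 0) {r : V}
    (hl : ∀ u, f r u = 0) (hr : ∀ u, f u r = 0) : r = 0 := by
  by_contra hr0
  let W : Submodule F V := LinearMap.ker f ⊓ LinearMap.ker f.flip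
  have hWl : ∀ w ∈ W, ∀ u, f w u = 0 := fun w hw u => LinearMap.congr_fun hw.1 u
  have hWr : ∀ w ∈ W, ∀ u, f u w = 0 := fun w hw u => LinearMap.congr_fun hw.2 u
  have hWmem : ∀ w, (∀ u, f w u = 0) → (∀ u, f u w = 0) → w ∈ W := fun w h1 h2 =>
    ⟨LinearMap.ext h1, LinearMap.ext h2⟩
  have hrW : r ∈ W := hWmem r hl hr
  obtain ⟨c, hc⟩ : ∃ c, c ∉ W := by
    by_contra! hall
    exact hf (LinearMap.ext fun v => LinearMap.ext fun u => hWl v (hall v) u)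
  obtain ⟨φ, hφ, hφW⟩ := Submodule.exists_dual_map_eq_bot_of_notMem hc inferInstance
  have hφW' : ∀ w ∈ W, φ w = 0 := fun w hw => by
    have := Submodule.mem_map_of_mem (f := φ) hw
    simpa [hφW] using this
  obtain ⟨C, hC⟩ := Submodule.exists_isCompl W
  have hmemL : ∀ y : Module.End F V, (∀ v, y v ∈ W) → y ∈ L f := fun y hy =>
    (mem_L _ _).2 fun v w => by rw [hWl _ (hy v), hWr _ (hy w), neg_zero]
  have hx : ∀ v, φ.smulRight r v ∈ W := fun v => W.smul_mem _ hrW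
  have hp : ∀ v, W.projection C hC v ∈ W := fun v => Submodule.projection_apply_mem hC v
  -- Every map into the two-sided radical `W` is skew. The map `φ ⊗ r` is fixed by left composition
  -- with the projection onto `W` and killed by right composition, so the two cannot commute.
  have := apply_comm_of_isReductive h W (fun y hy w hw => by
      rw [mem_L] at hy
      refine hWmem _ (fun u => by rw [hy, hWl w hw, neg_zero]) fun u => ?_
      rw [← neg_eq_zero, ← hy, hWr w hw])
    (hmemL _ hx) hx (fun w hw => by simp [hφW' w hw]) (hmemL _ hp) c
  rw [LinearMap.smulRight_apply, LinearMap.smulRight_apply, hφW' _ (hp c), map_smul,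
    Submodule.projection_apply_of_mem_left hC hrW, zero_smul] at this
  exact (smul_ne_zero hφ hr0) this

theorem not_isReductive_of_odd (h2 : (2 : F) ≠ 0) (hf : f ≠ 0) (hPQ : IsCompl P Q)
    (ho : Orthogonal f P Q) {n : ℕ} (hn : Odd n)
    (hP : HasGramMatrix (f.restrict P) (J F n)) : ¬ IsReductive F (L f) := by
  intro h
  by_cases hn1 : n = 1
  · subst hn1
    obtain ⟨b, hb⟩ := hP
    have h1 : f (b 0) (b 0) = 0 := by
      have := hb 0 0
      simpa [J] using this
    have hall : ∀ p : P, ∃ a : F, (p : V) = a • (b 0 : V) := fun p => ⟨b.repr p 0, by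
      conv_lhs => rw [← b.sum_repr p]
      simp⟩
    have h3 := eq_zero_of_isReductive_of_radical h hf (r := b 0)
      (fun u => by
        rw [← apply_projection_right hPQ ho (b 0).2]
        obtain ⟨a, ha⟩ := hall (P.projectionOnto Q hPQ u)
        rw [Submodule.coe_projectionOnto_apply] at ha
        rw [ha, map_smul, h1, smul_zero])
      (fun u => by
        rw [← apply_projection_left hPQ ho (b 0).2]
        obtain ⟨a, ha⟩ := hall (P.projectionOnto Q hPQ u)
        rw [Submodule.coe_projectionOnto_apply] at ha
        rw [ha, map_smul, LinearMap.smul_apply, h1, smul_zero])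
    exact b.ne_zero 0 (Subtype.ext h3)
  · obtain ⟨y, x, hy, hx, hxc, v, hv⟩ := exists_skew_not_commute hP hn hn1 h2
    have hxL := extendEnd_mem_L hPQ ho hx
    have hxV : ∀ v, extendEnd hPQ x v ∈ chainSubmodule f := fun v =>
      IsChainEnd.of_restrict hPQ ho (hxc _)
    have hxL' := (mem_L _ _).1 hxL
    -- The extended `x` kills chain ends: for such `w`, skewness and isotropy place `x w` in the
    -- two-sided radical, which is zero.
    have := apply_comm_of_isReductive h (chainSubmodule f)
      (fun z hz w hw => IsChainEnd.map ((mem_L _ _).1 hz) hw) hxL hxV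
      (fun w hw => eq_zero_of_isReductive_of_radical h hf
        (fun u => by rw [hxL', apply_eq_zero_of_isChainEnd hw (hxV u), neg_zero])
        (fun u => by
          rw [← neg_eq_zero, ← hxL', apply_eq_zero_of_isChainEnd (hxV u) hw]))
      (extendEnd_mem_L hPQ ho hy) v
    rw [extendEnd_of_mem_left, extendEnd_of_mem_left, extendEnd_of_mem_left,
      extendEnd_of_mem_left] at this
    exact hv (Subtype.ext this)

end Orthogonal

section Nondegenerate

variable {F : Type*} {V : Type*} [Field F] [AddCommGroup V] [Module F V] [FiniteDimensional F V]

theorem right_nondegenerate_of_left {f : BilinForm F V} {Q : Submodule F V}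
    (h : ∀ q ∈ Q, (∀ q' ∈ Q, f q q' = 0) → q = 0) :
    ∀ q ∈ Q, (∀ q' ∈ Q, f q' q = 0) → q = 0 := by
  intro q hq hq0
  have hinj : Function.Injective (f.restrict Q) := by
    refine (injective_iff_map_eq_zero _).2 fun a ha => Subtype.ext (h a a.2 fun b hb => ?_)
    exact LinearMap.congr_fun ha ⟨b, hb⟩
  have hsurj := (LinearMap.injective_iff_surjective_of_finrank_eq_finrank
    (Subspace.dual_finrank_eq (K := F) (V := Q)).symm).1 hinj
  have : (⟨q, hq⟩ : Q) = 0 := (Module.forall_dual_apply_eq_zero_iff F _).1 fun φ => by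
    obtain ⟨a, rfl⟩ := hsurj φ
    exact hq0 a a.2
  exact congrArg Subtype.val this

end Nondegenerate

section Zero

variable {F : Type*} {V : Type*} [Field F] [AddCommGroup V] [Module F V]

theorem nonempty_lieEquiv_end : Nonempty (L (0 : BilinForm F V) ≃ₗ⁅F⁆ Module.End F V) :=
  ⟨LieEquiv.ofBijective (L (0 : BilinForm F V)).incl
    ⟨Subtype.val_injective, fun x => ⟨⟨x, (mem_L _ _).2 fun _ _ => by simp⟩, rfl⟩⟩⟩

end Zero

/-! ### The even, odd and nondegenerate parts of a decomposition. -/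

section Decomposition

variable {F : Type*} {V : Type*} [Field F] [AddCommGroup V] [Module F V] {f : BilinForm F V}
  {m : ℕ} {U : Fin m → Submodule F V}

theorem exists_components (S : Set (Fin m)) {p : V} (hp : p ∈ ⨆ i ∈ S, U i) :
    ∃ c : Fin m → V, (∀ i, c i ∈ U i) ∧ (∀ i ∉ S, c i = 0) ∧ ∑ i, c i = p := by
  obtain ⟨c, hc, hsum⟩ := (Submodule.mem_iSup_iff_exists_finsupp _ _).1 hp
  refine ⟨c, fun i => (iSup_le fun _ => le_rfl : (⨆ _ : i ∈ S, U i) ≤ U i) (hc i), fun i hi => ?_, ?_⟩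
  · have := hc i
    simpa [hi] using this
  · rw [← hsum, Finsupp.sum_fintype _ _ fun _ => rfl]

namespace IsIndecomposableDecomposition

variable (hU : IsIndecomposableDecomposition f U)
include hU

theorem isCompl_biSup (S : Set (Fin m)) : IsCompl (⨆ i ∈ S, U i) (⨆ i ∈ Sᶜ, U i) := by
  obtain ⟨h1, h2⟩ :=
    DirectSum.isInternal_submodule_iff_iSupIndep_and_iSup_eq_top _ |>.1 hU.isInternal
  refine ⟨h1.disjoint_biSup_biSup disjoint_compl_right, codisjoint_iff.2 ?_⟩
  rw [← iSup_union, Set.union_compl_self, iSup_univ, h2]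

theorem orthogonal_biSup (S : Set (Fin m)) :
    Orthogonal f (⨆ i ∈ S, U i) (⨆ i ∈ Sᶜ, U i) := by
  intro a ha b hb
  obtain ⟨c, hc, hc0, rfl⟩ := exists_components S ha
  obtain ⟨d, hd, hd0, rfl⟩ := exists_components Sᶜ hb
  have key : ∀ i j, f (c i) (d j) = 0 ∧ f (d j) (c i) = 0 := by
    intro i j
    by_cases hi : i ∈ S
    · by_cases hj : j ∈ S
      · simp [hd0 j (by simpa using hj)]
      · exact hU.orthogonal i j (fun h => hj (h ▸ hi)) _ (hc i) _ (hd j)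
    · simp [hc0 i hi]
  simp [key]

theorem eq_zero_of_components (S : Set (Fin m)) {p : V} (hp : p ∈ ⨆ i ∈ S, U i)
    (h : ∀ i ∈ S, ∀ c ∈ U i, (∀ u ∈ U i, f c u = f p u) → (∀ u ∈ U i, f u c = f u p) → c = 0) :
    p = 0 := by
  obtain ⟨c, hc, hc0, rfl⟩ := exists_components S hp
  refine Finset.sum_eq_zero fun i _ => ?_
  by_cases hi : i ∈ S
  · refine h i hi _ (hc i) (fun u hu => ?_) fun u hu => ?_
    · rw [map_sum, LinearMap.sum_apply, Finset.sum_eq_single i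
        (fun j _ hj => (hU.orthogonal j i hj _ (hc j) u hu).1) (by simp)]
    · rw [map_sum, Finset.sum_eq_single i
        (fun j _ hj => (hU.orthogonal j i hj _ (hc j) u hu).2) (by simp)]
  · exact hc0 i hi

theorem isReductive_imp_oddPart_eq_bot (h2 : (2 : F) ≠ 0) (hf : f ≠ 0)
    (h : IsReductive F (L f)) : oddPart f U = ⊥ := by
  rw [oddPart, iSup₂_eq_bot]
  rintro i ⟨n, hn, hg⟩
  have h1 := hU.isCompl_biSup {i}
  have h3 := hU.orthogonal_biSup {i}
  rw [iSup_singleton] at h1 h3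
  exact absurd h (not_isReductive_of_odd h2 hf h1 h3 hn hg)

variable [FiniteDimensional F V]

/-- A nonzero component of `q` would lie in the left radical of its `U i`, forcing that summand to
be a Jordan block. -/
theorem ndegPart_left_nondegenerate (q : V) (hq : q ∈ ndegPart f U)
    (h : ∀ q' ∈ ndegPart f U, f q q' = 0) : q = 0 := by
  refine hU.eq_zero_of_components _ hq fun i hi c hc hl _ => ?_
  by_contra hc0
  refine hi ((hU.indecomposable i).exists_hasGramMatrix (l₀ := ⟨c, hc⟩) ?_ fun h => ?_)
  · refine LinearMap.ext fun u => ?_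
    change f c u = 0
    rw [hl u u.2]
    exact h u (Submodule.mem_iSup_of_mem i (Submodule.mem_iSup_of_mem hi u.2))
  · exact hc0 (congrArg Subtype.val h)

omit [FiniteDimensional F V] in
theorem evenPart_radical (p : V) (hp : p ∈ evenPart f U)
    (hl : ∀ u ∈ evenPart f U, f p u = 0) (hr : ∀ u ∈ evenPart f U, f u p = 0) : p = 0 := by
  refine hU.eq_zero_of_components _ hp fun i hi c hc h1 h3 => ?_
  have hle : ∀ u ∈ U i, u ∈ evenPart f U := fun u hu =>
    Submodule.mem_iSup_of_mem i (Submodule.mem_iSup_of_mem hi hu)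
  obtain ⟨n, hn, hg⟩ := hi
  have := eq_zero_of_hasGramMatrix hg (c := ⟨c, hc⟩) (by rintro rfl; simp at hn)
    (fun u => (h1 u u.2).trans (hl u (hle u u.2)))
    (fun u => (h3 u u.2).trans (hr u (hle u u.2)))
  exact congrArg Subtype.val this

omit [FiniteDimensional F V] in
theorem evenPart_le_chain : evenPart f U ≤ chainSubmodule f ⊔ chainSubmodule f.flip := by
  refine iSup₂_le ?_
  rintro i ⟨n, hn, hg⟩ u hu
  have h1 := hU.isCompl_biSup {i}
  have h3 := hU.orthogonal_biSup {i}
  rw [iSup_singleton] at h1 h3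
  have h4 : (⟨u, hu⟩ : U i) ∈
      chainSubmodule (f.restrict (U i)) ⊔ chainSubmodule (f.restrict (U i)).flip := by
    rw [chainSubmodule_sup_flip hg hn]
    exact Submodule.mem_top
  obtain ⟨a, ha, b, hb, hab⟩ := Submodule.mem_sup.1 h4
  have hu' : u = a + b := congrArg Subtype.val hab.symm
  rw [hu']
  refine Submodule.add_mem_sup (IsChainEnd.of_restrict h1 h3 ha) ?_
  exact IsChainEnd.of_restrict (f := f.flip) h1 (fun x hx y hy => (h3 x hx y hy).symm) hb

omit [FiniteDimensional F V] in
theorem ndegPart_eq (h : oddPart f U = ⊥) : ndegPart f U =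
    ⨆ i ∈ {i | ∃ n, Even n ∧ HasGramMatrix (f.restrict (U i)) (J F n)}ᶜ, U i := by
  have hS : {i | ¬ ∃ n, HasGramMatrix (f.restrict (U i)) (J F n)} =
      {i | ∃ n, Even n ∧ HasGramMatrix (f.restrict (U i)) (J F n)}ᶜ := by
    ext i
    simp only [Set.mem_ofPred_eq, Set.mem_compl_iff]
    refine not_congr ⟨?_, fun ⟨n, _, hg⟩ => ⟨n, hg⟩⟩
    rintro ⟨n, hg⟩
    refine ⟨n, (Nat.even_or_odd n).resolve_right fun hn => ?_, hg⟩
    rw [oddPart, iSup₂_eq_bot] at h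
    have := (hU.indecomposable i).1
    exact Submodule.nontrivial_iff_ne_bot.1 this (h i ⟨n, hn, hg⟩)
  rw [ndegPart, hS]

theorem nonempty_lieEquiv (h : oddPart f U = ⊥) :
    Nonempty (L f ≃ₗ⁅F⁆ L (f.restrict (evenPart f U)) × L (f.restrict (ndegPart f U))) := by
  have hc : IsCompl (evenPart f U) (ndegPart f U) := by
    rw [hU.ndegPart_eq h]
    exact hU.isCompl_biSup _
  have ho : Orthogonal f (evenPart f U) (ndegPart f U) := by
    rw [hU.ndegPart_eq h]
    exact hU.orthogonal_biSup _
  have hle : ∀ a, IsChainEnd f a → a ∈ evenPart f U := fun a ha =>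
    ha.mem_of_isCompl hc ho hU.ndegPart_left_nondegenerate
  have hle' : ∀ a, IsChainEnd f.flip a → a ∈ evenPart f U := fun a ha =>
    ha.mem_of_isCompl hc (fun x hx y hy => (ho x hx y hy).symm)
      (right_nondegenerate_of_left hU.ndegPart_left_nondegenerate)
  -- Both chain subspaces are invariant and contained in `evenPart`, and together they span it.
  have hinv : ∀ x ∈ L f, ∀ p ∈ evenPart f U, x p ∈ evenPart f U := by
    intro x hx p hp
    rw [mem_L] at hx
    obtain ⟨a, ha, b, hb, rfl⟩ := Submodule.mem_sup.1 (hU.evenPart_le_chain hp)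
    rw [map_add]
    refine add_mem (hle _ (IsChainEnd.map hx ha)) (hle' _ (IsChainEnd.map (fun v w => ?_) hb))
    change f w (x v) = -f (x w) v
    rw [hx, neg_neg]
  exact nonempty_lieEquiv_prod hc ho hinv fun x hx =>
    apply_mem_of_orthogonal hc ho hU.evenPart_radical hx (hinv x hx)

end IsIndecomposableDecomposition

end Decomposition

end FormLie

theorem mainTheorem7 {F : Type*} {V : Type*} [Field F] [AddCommGroup V] [Module F V]
    [FiniteDimensional F V] [Nontrivial V] (hF : ringChar F ≠ 2)
    (f : LinearMap.BilinForm F V) {m : ℕ} (U : Fin m → Submodule F V)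
    (hU : FormLie.IsIndecomposableDecomposition f U) :
    (FormLie.IsReductive F (FormLie.L f) ↔
      f = 0 ∨
        (FormLie.oddPart f U = ⊥ ∧
          FormLie.IsReductive F (FormLie.L (f.restrict (FormLie.evenPart f U))) ∧
          FormLie.IsReductive F (FormLie.L (f.restrict (FormLie.ndegPart f U))))) ∧
    (f = 0 →
      Nonempty (FormLie.L f ≃ₗ⁅F⁆
        Matrix (Fin (Module.finrank F V)) (Fin (Module.finrank F V)) F)) ∧
    (FormLie.oddPart f U = ⊥ ∧
        FormLie.IsReductive F (FormLie.L (f.restrict (FormLie.evenPart f U))) ∧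
        FormLie.IsReductive F (FormLie.L (f.restrict (FormLie.ndegPart f U))) →
      Nonempty (FormLie.L f ≃ₗ⁅F⁆
        (FormLie.L (f.restrict (FormLie.evenPart f U)) ×
          FormLie.L (f.restrict (FormLie.ndegPart f U))))) := by
  have h2 : (2 : F) ≠ 0 := Ring.two_ne_zero hF
  refine ⟨⟨fun h => ?_, ?_⟩, ?_, fun h => hU.nonempty_lieEquiv h.1⟩
  · refine or_iff_not_imp_left.2 fun hf => ?_
    have hodd := hU.isReductive_imp_oddPart_eq_bot h2 hf h
    obtain ⟨e⟩ := hU.nonempty_lieEquiv hodd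
    have := h.of_lieEquiv e
    exact ⟨hodd, this.prod_left, this.prod_right⟩
  · rintro (rfl | ⟨hodd, h₁, h₃⟩)
    · obtain ⟨e⟩ := FormLie.nonempty_lieEquiv_end (F := F) (V := V)
      exact (FormLie.isReductive_end h2).of_lieEquiv e.symm
    · obtain ⟨e⟩ := hU.nonempty_lieEquiv hodd
      exact (h₁.prod h₃).of_lieEquiv e.symm
  · rintro rfl
    obtain ⟨e⟩ := FormLie.nonempty_lieEquiv_end (F := F) (V := V)
    exact ⟨e.trans (LinearMap.toMatrixAlgEquiv (Module.finBasis F V)).toLieEquiv⟩
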